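/- Protocols and privacy. An $m$-message protocol for $n\ge 2$ users, with finite message space $Y$, consists of a local randomizer $R$, which maps an input $x\in[0,1]$ to a random vector in $Y^m$, and an analyzer $A:(Y^n)^m\to\mathbb{R}$. On input $x=(x_1,\dots,x_n)\in[0,1]^n$ the users independently draw $R(x_1),\dots,R(x_n)$. In the shuffle model with $m$ parallel shufflers, for each $j\in\{1,\dots,m\}$ an independent uniformly random permutation is applied to the $n$-tuple of the users' $j$-th messages; in the single-shuffler model one uniformly random permutation is applied to all $nm$ messages together, and the result is again listed as $m$ tuples of length $n$. In either model the resulting random element $V(x)$ of $(Y^n)^m$ is the view of the data collector, and $A(V(x))$ is the output. The protocol is $(\varepsilon,\delta)$-DP if $\Pr[V(x)\in E]-e^{\varepsilon}\Pr[V(x')\in E]\le\delta$ for all $x,x'\in[0,1]^n$ differing in one coordinate and all events $E$. Its mean squared error for real summation is $\mathrm{MSE}=\sup_{x\in[0,1]^n}\mathbb{E}\big[(A(V(x))-\sum_{i=1}^n x_i)^2\big]$. The length of a message is $\lceil\log_2|Y|\rceil$ bits. Theorem. There are absolute constants $C_1,C_2$ and, for every $\varepsilon_0>0$, a constant $C_3=C_3(\varepsilon_0)$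 such that for all integers $n\ge2$, all $0<\varepsilon\le\varepsilon_0$ and all $0<\delta\le1$ there is an $m$-message protocol for $n$ users, with $1\le m\le C_1\log(n/\delta)$ and with messages of at most $C_2\log n$ bits, which, both in the shuffle model with $m$ parallel shufflers and in the single-shuffler model, is $(\varepsilon,\delta)$-DP and has $\mathrm{MSE}\le C_3/\varepsilon^2$. In short: MSE $O(1/\varepsilon^2)$ for bounded $\varepsilon$, with $O(\log(n/\delta))$ messages per user, each of length $O(\log n)$ bits. -/

import Mathlib

open scoped ENNReal

namespace Shuffle

theorem tsum_prod_fin {α : Type*} (n : ℕ) (p : Fin n → PMF α) :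
    ∑' f : Fin n → α, ∏ i, p i (f i) = 1 := by
  induction n with
  | zero => simp
  | succ n ih =>
    rw [← (Fin.consEquiv (fun _ : Fin (n + 1) => α)).tsum_eq, ENNReal.tsum_prod']
    simp only [Fin.consEquiv_apply, Fin.prod_univ_succ, Fin.cons_zero, Fin.cons_succ,
      ENNReal.tsum_mul_left, ih (fun i => p i.succ), mul_one, PMF.tsum_coe]

/-- The joint law of independent random variables with laws `p 0, …, p (n - 1)`. -/
noncomputable def independent {α : Type*} {n : ℕ} (p : Fin n → PMF α) : PMF (Fin n → α) :=
  ⟨fun f => ∏ i, p i (f i), by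
    rw [← tsum_prod_fin n p]
    exact ENNReal.summable.hasSum⟩

/-- An `m`-message protocol for `n` users with input space `X`, message space `Y` and output
space `O`: a local randomizer, the same for every user, and an analyzer. The analyzer reads
the `j`-th output tuple of the shuffling stage as its `j`-th argument. -/
structure Protocol (X Y O : Type*) (n m : ℕ) where
  randomizer : X → PMF (Fin m → Y)
  analyzer : (Fin m → Fin n → Y) → O

namespace Protocol

variable {X Y O : Type*} {n m : ℕ}

/-- The messages before shuffling: entry `i j` is the `j`-th message of user `i`, and the
users randomize independently. -/
noncomputable def messages (P : Protocol X Y O n m) (x : Fin n → X) :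
    PMF (Fin n → Fin m → Y) :=
  independent fun i => P.randomizer (x i)

/-- The view of the data collector with `m` parallel shufflers: the `j`-th shuffler applies
its own independent uniformly random permutation to the `j`-th messages of all users. -/
noncomputable def parallelView (P : Protocol X Y O n m) (x : Fin n → X) :
    PMF (Fin m → Fin n → Y) :=
  (P.messages x).bind fun y =>
    (PMF.uniformOfFintype (Fin m → Equiv.Perm (Fin n))).map fun π j i => y (π j i) j

/-- The view of the data collector with a single shuffler: one uniformly random permutation
is applied to all `n * m` messages together. -/
noncomputable def singleView (P : Protocol X Y O n m) (x : Fin n → X) :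
    PMF (Fin m → Fin n → Y) :=
  (P.messages x).bind fun y =>
    (PMF.uniformOfFintype (Equiv.Perm (Fin m × Fin n))).map fun π j i =>
      y (π (j, i)).2 (π (j, i)).1

end Protocol

/-- `x` and `x'` differ in at most one coordinate. -/
def Neighbors {X : Type*} {n : ℕ} (x x' : Fin n → X) : Prop :=
  ∃ i, ∀ k, k ≠ i → x k = x' k

/-- `(ε, δ)`-differential privacy of a randomized map on `n`-tuples of data. -/
def IsDP {X V : Type*} {n : ℕ} (ε δ : ℝ) (M : (Fin n → X) → PMF V) : Prop :=
  ∀ x x' : Fin n → X, Neighbors x x' → ∀ E : Set V,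
    ((M x).toOuterMeasure E).toReal - Real.exp ε * ((M x').toOuterMeasure E).toReal ≤ δ

/-- Worst-case mean squared error of a randomized estimate of `∑ i, x i` for `x ∈ [0,1]ⁿ`. -/
noncomputable def mse {n : ℕ} (M : (Fin n → Set.Icc (0 : ℝ) 1) → PMF ℝ) : ℝ≥0∞ :=
  ⨆ x : Fin n → Set.Icc (0 : ℝ) 1,
    ∑' z : ℝ, M x z * ENNReal.ofReal ((z - ∑ i, (x i : ℝ)) ^ 2)

/-- Number of bits of a message: the least `b` such that `Y` can be encoded injectively by
bit strings of length `b`. -/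
def messageBits (Y : Type*) [Fintype Y] : ℕ := Nat.clog 2 (Fintype.card Y)

end Shuffle

/-! Each user rounds the input down to a multiple of `1 / n`, adds a small noise share, and splits
the result into `m` additive shares in `ZMod q`, where `q = 4 * n ^ 2`. Two facts make this private
and accurate.

Shuffled shares reveal essentially only their total. Move an amount `a` from user `i` to user `i'`,
and let `X` be the difference of the indicators of the two sets of share matrices (row sums before
and after). Either shuffler is blind to exchanging the entries of `i` and `i'` in any set `b` of
columns, so `X` may be replaced by its average over the `2 ^ m` exchanges. The exchanged copies of
`X` are pairwise orthogonal unless their column sets are equal or complementary, and all are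
supported on `|A|` sets of equal size. Cauchy–Schwarz then bounds the change in any event's
probability by `2 * √(|A| / 2 ^ m)` (`abs_sum_rowSumFiber_sub_le`). Collecting all values at one
user costs this at most `n` times, so inputs with equal sums are nearly indistinguishable.

The total carries discrete Laplace noise. The geometric law is infinitely divisible: it is the sum
of `n` independent Pólya variables, so each user adds a difference of two of them. One user changes
the rounded total by at most `n`; with ratio `α = exp (-η / n)` this costs a factor `α ^ n = exp
(-η)`. Divided by `n`, the noise has second moment of order `1 / η ^ 2`, while rounding contributes
at most `1` to the error. Taking `m` of order `log (n / δ)` brings the sharing error below `δ`. -/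

namespace Shuffle

set_option linter.unusedSectionVars false

/-! ### Exchanging shares between two users: the second moment bound -/

section Combinatorics

variable {ι κ A : Type*}

/-- The sum of the entries of each row. -/
def rowSum [Fintype κ] [AddCommMonoid A] (y : ι → κ → A) : ι → A := fun i => ∑ j, y i j

/-- Exchange the rows `i` and `i'` in the columns belonging to `b`. -/
def swapOn [DecidableEq ι] [DecidableEq κ] {A : Type*} (i i' : ι) (b : Finset κ)
    (y : ι → κ → A) : ι → κ → A :=
  fun k j => if j ∈ b then y (Equiv.swap i i' k) j else y k j

variable [DecidableEq ι] [DecidableEq κ]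

theorem swapOn_swapOn (i i' : ι) (b c : Finset κ) (y : ι → κ → A) :
    swapOn i i' b (swapOn i i' c y) = swapOn i i' (symmDiff b c) y := by
  funext k j
  simp only [swapOn, Finset.mem_symmDiff]
  by_cases hb : j ∈ b <;> by_cases hc : j ∈ c <;> simp [hb, hc]

theorem swapOn_involutive (i i' : ι) (b : Finset κ) :
    Function.Involutive (swapOn (A := A) i i' b) := by
  intro y
  rw [swapOn_swapOn, symmDiff_self]
  funext k j
  simp [swapOn]

theorem swapOn_add [Add A] (i i' : ι) (b : Finset κ) (y z : ι → κ → A) :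
    swapOn i i' b (y + z) = swapOn i i' b y + swapOn i i' b z := by
  funext k j
  simp only [swapOn, Pi.add_apply]
  split_ifs <;> rfl

variable [Fintype κ]

theorem rowSum_add [AddCommMonoid A] (y z : ι → κ → A) :
    rowSum (y + z) = rowSum y + rowSum z := by
  funext i
  simp [rowSum, Finset.sum_add_distrib]

theorem rowSum_swapOn_of_ne [AddCommMonoid A] {i i' k : ι} (hi : k ≠ i) (hi' : k ≠ i')
    (b : Finset κ) (y : ι → κ → A) : rowSum (swapOn i i' b y) k = rowSum y k := by
  simp [rowSum, swapOn, Equiv.swap_apply_of_ne_of_ne hi hi']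

theorem rowSum_swapOn_add [AddCommMonoid A] (i i' : ι) (b : Finset κ) (y : ι → κ → A) :
    rowSum (swapOn i i' b y) i + rowSum (swapOn i i' b y) i' = rowSum y i + rowSum y i' := by
  simp only [rowSum, swapOn, ← Finset.sum_add_distrib]
  refine Finset.sum_congr rfl fun j _ => ?_
  split_ifs
  · simp [add_comm]
  · rfl

/-- Row `i` carries `a` in a column of `d` and `-a` in a column outside `d`. The exchange moves only
the first entry to row `i'`. Such a pair of columns exists precisely because `d` is neither empty
nor full. -/
theorem exists_rowSum_eq_zero_and_rowSum_swapOn_eq [AddCommGroup A] {i i' : ι} (hne : i ≠ i')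
    (a : A) {d : Finset κ} (h0 : d ≠ ∅) (h1 : d ≠ Finset.univ) :
    ∃ r : ι → κ → A, rowSum r = 0 ∧
      rowSum (swapOn i i' d r) = Pi.single i' a - Pi.single i a := by
  obtain ⟨j, hj⟩ := Finset.nonempty_iff_ne_empty.2 h0
  obtain ⟨k, hk⟩ : ∃ k, k ∉ d := by
    by_contra! h
    exact h1 (Finset.eq_univ_iff_forall.2 h)
  refine ⟨Pi.single i (Pi.single j a - Pi.single k a : κ → A), ?_, ?_⟩
  · funext l
    by_cases hl : l = i
    · subst hl
      simp [rowSum, Finset.sum_sub_distrib]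
    · simp [rowSum, hl]
  · have : swapOn i i' d (Pi.single i (Pi.single j a - Pi.single k a : κ → A)) =
        Pi.single i' (Pi.single j a : κ → A) - Pi.single i (Pi.single k a : κ → A) := by
      funext l c
      have hjk : j ≠ k := fun h => hk (h ▸ hj)
      simp only [swapOn]
      by_cases hl : l = i
      · subst hl
        by_cases hc : c ∈ d
        · have : c ≠ k := fun h => hk (h ▸ hc)
          simp [hc, hne, hne.symm, this]
        · have : c ≠ j := fun h => hc (h ▸ hj)
          simp [hc, hne, this]
      · by_cases hl' : l = i'
        · subst hl'
          by_cases hc : c ∈ d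
          · have : c ≠ k := fun h => hk (h ▸ hc)
            simp [hc, hne.symm, this]
          · have : c ≠ j := fun h => hc (h ▸ hj)
            simp [hc, hne.symm, this]
        · simp [Equiv.swap_apply_of_ne_of_ne hl hl', hl, hl']
    rw [this]
    funext l
    simp only [rowSum, Pi.sub_apply, Finset.sum_sub_distrib]
    by_cases hl : l = i <;> by_cases hl' : l = i' <;> simp_all

variable [Fintype ι] [Fintype A] [DecidableEq A] [AddCommGroup A]

/-- The matrices with prescribed row sums. -/
def rowSumFiber (κ : Type*) [Fintype κ] [DecidableEq κ] (v : ι → A) : Finset (ι → κ → A) :=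
  Finset.univ.filter fun y => rowSum y = v

theorem mem_rowSumFiber {v : ι → A} {y : ι → κ → A} : y ∈ rowSumFiber κ v ↔ rowSum y = v := by
  simp [rowSumFiber]

theorem card_rowSumFiber [Nonempty κ] (v w : ι → A) :
    (rowSumFiber κ v).card = (rowSumFiber κ w).card := by
  let j : κ := Classical.arbitrary κ
  let r : ι → κ → A := fun i => Pi.single j (w i - v i)
  have hr : rowSum r = w - v := by funext i; simp [rowSum, r]
  refine Finset.card_bij' (fun y _ => y + r) (fun y _ => y - r) ?_ ?_ ?_ ?_
  · intro y hy
    rw [mem_rowSumFiber] at *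
    rw [rowSum_add, hy, hr]; abel
  · intro y hy
    rw [mem_rowSumFiber] at *
    have := rowSum_add (y - r) r
    rw [sub_add_cancel, hy, hr] at this
    exact add_right_cancel (this.symm.trans (add_sub_cancel v w).symm)
  · simp
  · simp

/-- The difference of the indicators of two row sum conditions. -/
def fiberDiff (v v' : ι → A) (y : ι → κ → A) : ℝ :=
  (if rowSum y = v then 1 else 0) - (if rowSum y = v' then 1 else 0)

theorem sum_fiberDiff_mul (v v' : ι → A) (h : (ι → κ → A) → ℝ) :
    ∑ y, fiberDiff v v' y * h y = ∑ y ∈ rowSumFiber κ v, h y - ∑ y ∈ rowSumFiber κ v', h y := by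
  simp [fiberDiff, sub_mul, Finset.sum_sub_distrib, rowSumFiber, Finset.sum_filter]

theorem sum_comp_swapOn (i i' : ι) (b : Finset κ) (f : (ι → κ → A) → ℝ) :
    ∑ y, f (swapOn i i' b y) = ∑ y, f y :=
  Equiv.sum_comp (swapOn_involutive i i' b).toPerm f

/-- Orthogonality: translating by the matrix `r` of the previous lemma leaves the first factor
unchanged and turns one of the two conditions on the exchanged matrix into the other, so the two
halves of the second factor cancel. -/
theorem sum_fiberDiff_mul_fiberDiff_swapOn {i i' : ι} (hne : i ≠ i') (v : ι → A) (a : A)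
    {d : Finset κ} (h0 : d ≠ ∅) (h1 : d ≠ Finset.univ) :
    ∑ y, fiberDiff v (v + (Pi.single i' a - Pi.single i a)) y *
      fiberDiff v (v + (Pi.single i' a - Pi.single i a)) (swapOn i i' d y) = 0 := by
  obtain ⟨r, hr0, hr1⟩ := exists_rowSum_eq_zero_and_rowSum_swapOn_eq hne a h0 h1
  set t : ι → A := Pi.single i' a - Pi.single i a
  set X : (ι → κ → A) → ℝ := fiberDiff v (v + t)
  have key : ∑ y, X y * (if rowSum (swapOn i i' d y) = v then (1 : ℝ) else 0) =
      ∑ y, X y * (if rowSum (swapOn i i' d y) = v + t then (1 : ℝ) else 0) := by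
    rw [← Equiv.sum_comp (Equiv.addRight r) fun y =>
      X y * (if rowSum (swapOn i i' d y) = v + t then (1 : ℝ) else 0)]
    refine Finset.sum_congr rfl fun y _ => ?_
    simp only [Equiv.coe_addRight, swapOn_add, rowSum_add, hr1, add_left_inj, X, fiberDiff, hr0,
      add_zero]
  have : ∀ y, X y * X (swapOn i i' d y) =
      X y * (if rowSum (swapOn i i' d y) = v then (1 : ℝ) else 0) -
      X y * (if rowSum (swapOn i i' d y) = v + t then (1 : ℝ) else 0) := by
    intro y
    rw [← mul_sub]
    rfl
  simp only [this, Finset.sum_sub_distrib, key, sub_self]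

theorem abs_fiberDiff_le_one (v v' : ι → A) (y : ι → κ → A) : |fiberDiff v v' y| ≤ 1 := by
  unfold fiberDiff
  split_ifs <;> norm_num

theorem sum_abs_fiberDiff_le [Nonempty κ] (v v' : ι → A) :
    ∑ y, |fiberDiff (κ := κ) v v' y| ≤ 2 * (rowSumFiber κ v).card := by
  have : ∀ y : ι → κ → A, |fiberDiff v v' y| ≤
      (if rowSum y = v then 1 else 0) + (if rowSum y = v' then 1 else 0) := by
    intro y
    unfold fiberDiff
    split_ifs <;> norm_num
  refine (Finset.sum_le_sum fun y _ => this y).trans ?_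
  rw [Finset.sum_add_distrib, two_mul]
  nth_rewrite 2 [card_rowSumFiber v v']
  simp [rowSumFiber]

/-- Expanding the square gives `2 ^ |κ|` copies of the correlations `T d`. Only `d = ∅` and `d =
univ` can contribute, each at most the `ℓ¹` norm of `X`. -/
theorem sum_sq_sum_fiberDiff_swapOn_le [Nonempty κ] {i i' : ι} (hne : i ≠ i') (v : ι → A)
    (a : A) :
    ∑ y, (∑ b : Finset κ,
      fiberDiff v (v + (Pi.single i' a - Pi.single i a)) (swapOn i i' b y)) ^ 2 ≤
      4 * 2 ^ Fintype.card κ * (rowSumFiber κ v).card := by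
  set t : ι → A := Pi.single i' a - Pi.single i a
  set X : (ι → κ → A) → ℝ := fiberDiff v (v + t)
  set T : Finset κ → ℝ := fun d => ∑ y, X y * X (swapOn i i' d y)
  have hT : ∀ d, T d ≤ if d = ∅ ∨ d = Finset.univ then 2 * ((rowSumFiber κ v).card : ℝ) else 0 := by
    intro d
    split_ifs with h
    · refine le_trans (Finset.sum_le_sum fun y _ => ?_) (sum_abs_fiberDiff_le v (v + t))
      calc X y * X (swapOn i i' d y) ≤ |X y * X (swapOn i i' d y)| := le_abs_self _
        _ = |X y| * |X (swapOn i i' d y)| := abs_mul _ _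
        _ ≤ |X y| * 1 := by gcongr; exact abs_fiberDiff_le_one _ _ _
        _ = |X y| := mul_one _
    · rw [not_or] at h
      exact (sum_fiberDiff_mul_fiberDiff_swapOn hne v a h.1 h.2).le
  have expand : ∑ y, (∑ b : Finset κ, X (swapOn i i' b y)) ^ 2 = ∑ _b : Finset κ, ∑ d, T d := by
    simp only [sq, Finset.sum_mul_sum]
    rw [Finset.sum_comm]
    refine Finset.sum_congr rfl fun b _ => ?_
    rw [Finset.sum_comm]
    -- The pair `(b, c)` is reindexed as `(b, b ∆ d)`; applying the exchange on `b` to the summation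
    -- variable leaves a correlation depending on `d` alone.
    have hinv : Function.Involutive (symmDiff b) := fun d => symmDiff_symmDiff_cancel_left b d
    rw [← Equiv.sum_comp hinv.toPerm]
    refine Finset.sum_congr rfl fun d _ => ?_
    simp only [Function.Involutive.coe_toPerm, T]
    rw [← sum_comp_swapOn i i' b fun y => X y * X (swapOn i i' d y)]
    simp only [swapOn_swapOn, symmDiff_comm d b]
  rw [expand, Finset.sum_const, Finset.card_univ, Fintype.card_finset, nsmul_eq_mul]
  have hsum : ∑ d, T d ≤ 4 * ((rowSumFiber κ v).card : ℝ) := by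
    refine (Finset.sum_le_sum fun d _ => hT d).trans ?_
    rw [← Finset.sum_filter, Finset.sum_const, nsmul_eq_mul]
    have : (Finset.univ.filter fun d : Finset κ => d = ∅ ∨ d = Finset.univ).card ≤ 2 := by
      refine (Finset.card_le_card (t := {∅, Finset.univ}) ?_).trans Finset.card_le_two
      intro d
      simp
    have : ((Finset.univ.filter fun d : Finset κ => d = ∅ ∨ d = Finset.univ).card : ℝ) ≤ 2 := by
      exact_mod_cast this
    have hc : (0 : ℝ) ≤ (rowSumFiber κ v).card := Nat.cast_nonneg _
    nlinarith
  push_cast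
  have : (0 : ℝ) < 2 ^ Fintype.card κ := by positivity
  nlinarith

/-- An exchange preserves the other row sums and the sum of rows `i` and `i'`, so the support is
confined to a one-parameter family of fibers. -/
theorem rowSum_eq_of_fiberDiff_swapOn_ne_zero {i i' : ι} (hne : i ≠ i') {v : ι → A} {a : A}
    {b : Finset κ} {y : ι → κ → A}
    (h : fiberDiff v (v + (Pi.single i' a - Pi.single i a)) (swapOn i i' b y) ≠ 0) :
    ∃ c : A, rowSum y = v + (Pi.single i' c - Pi.single i c) := by
  have h1 : ∃ c, rowSum (swapOn i i' b y) = v + (Pi.single i' c - Pi.single i c) := by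
    by_contra! hc
    have h0 := hc 0
    simp only [Pi.single_zero, sub_self, add_zero] at h0
    simp [fiberDiff, hc a, h0] at h
  obtain ⟨c, hc⟩ := h1
  refine ⟨rowSum y i' - v i', ?_⟩
  have hs := rowSum_swapOn_add i i' b y
  funext k
  by_cases hk : k = i
  · subst hk
    simp only [hc, Pi.add_apply, Pi.sub_apply, Pi.single_eq_same, ne_eq, hne, hne.symm,
      not_false_eq_true, Pi.single_eq_of_ne] at hs ⊢
    have : rowSum y k = v k + v i' - rowSum y i' := by
      rw [eq_sub_iff_add_eq, ← hs]; abel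
    rw [this]; abel
  · by_cases hk' : k = i'
    · subst hk'
      simp [hk]
    · rw [← rowSum_swapOn_of_ne hk hk' b y, hc]
      simp [hk, hk']

theorem abs_sum_rowSumFiber_sub_le [Nonempty κ] {i i' : ι} (hne : i ≠ i') (v : ι → A) (a : A)
    (h : (ι → κ → A) → ℝ) (h0 : ∀ y, 0 ≤ h y) (h1 : ∀ y, h y ≤ 1)
    (hswap : ∀ b y, h (swapOn i i' b y) = h y) :
    |∑ y ∈ rowSumFiber κ v, h y -
      ∑ y ∈ rowSumFiber κ (v + (Pi.single i' a - Pi.single i a)), h y| ≤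
      2 * (rowSumFiber κ v).card * √(Fintype.card A / 2 ^ Fintype.card κ) := by
  set t : ι → A := Pi.single i' a - Pi.single i a with ht
  set X : (ι → κ → A) → ℝ := fiberDiff v (v + t) with hX
  set D : (ι → κ → A) → ℝ := fun y => ∑ b : Finset κ, X (swapOn i i' b y) with hD
  set K : ℝ := ((rowSumFiber κ v).card : ℝ) with hK
  rw [← sum_fiberDiff_mul]
  -- Invariance of `h` lets the sum `D` over all exchanges stand in for `X`.
  have hDh : 2 ^ Fintype.card κ * ∑ y, X y * h y = ∑ y, D y * h y := by
    simp only [hD, Finset.sum_mul]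
    rw [Finset.sum_comm]
    have : ∀ b : Finset κ, ∑ y, X (swapOn i i' b y) * h y = ∑ y, X y * h y := by
      intro b
      rw [← sum_comp_swapOn i i' b fun y => X y * h y]
      simp only [hswap]
    simp only [this, Finset.sum_const, Finset.card_univ, Fintype.card_finset, nsmul_eq_mul]
    push_cast
    rfl
  -- `U` contains the support of `D`: at most `|A|` fibers of size `K`. This gives the factor `|A|`
  -- in Cauchy–Schwarz.
  set U : Finset (ι → κ → A) :=
    Finset.univ.biUnion fun c : A => rowSumFiber κ (v + (Pi.single i' c - Pi.single i c)) with hU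
  have hUcard : (U.card : ℝ) ≤ Fintype.card A * K := by
    have : U.card ≤ Fintype.card A * (rowSumFiber κ v).card := by
      refine Finset.card_biUnion_le.trans ?_
      rw [Finset.sum_congr rfl fun c _ => card_rowSumFiber (κ := κ) _ v]
      simp
    rw [hK]
    exact_mod_cast this
  have hDU : ∀ y, y ∉ U → D y = 0 := by
    intro y hy
    refine Finset.sum_eq_zero fun b _ => ?_
    by_contra hb
    obtain ⟨c, hc⟩ := rowSum_eq_of_fiberDiff_swapOn_ne_zero hne hb
    exact hy (by simpa [hU, mem_rowSumFiber] using ⟨c, hc⟩)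
  have hsumU : ∑ y, D y * h y = ∑ y ∈ U, D y * h y := by
    symm
    refine Finset.sum_subset (Finset.subset_univ _) fun y _ hy => ?_
    rw [hDU y hy, zero_mul]
  have hcs : (∑ y, D y * h y) ^ 2 ≤ 4 * 2 ^ Fintype.card κ * K * (Fintype.card A * K) := by
    rw [hsumU]
    refine (Finset.sum_mul_sq_le_sq_mul_sq U D h).trans ?_
    refine mul_le_mul ?_ ?_ (by positivity) (by positivity)
    · refine le_trans ?_ (sum_sq_sum_fiberDiff_swapOn_le hne v a)
      exact Finset.sum_le_sum_of_subset_of_nonneg (Finset.subset_univ _) fun _ _ _ => sq_nonneg _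
    · refine le_trans (Finset.sum_le_sum (g := fun _ => (1 : ℝ)) fun y _ => ?_) (by simpa using hUcard)
      exact pow_le_one₀ (h0 y) (h1 y)
  refine abs_le_of_sq_le_sq ?_ (by positivity)
  have hp : (0 : ℝ) < 2 ^ Fintype.card κ := by positivity
  rw [mul_pow, Real.sq_sqrt (by positivity), ← mul_le_mul_iff_right₀ (pow_pos hp 2), ← mul_pow, hDh]
  refine hcs.trans (le_of_eq ?_)
  field_simp
  ring

end Combinatorics

/-! ### Averages over share matrices depend almost only on the total -/

section FiberMean

variable {ι κ A : Type*} [DecidableEq ι] [DecidableEq κ] [Fintype ι] [Fintype κ] [Nonempty κ]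
  [Fintype A] [DecidableEq A] [AddCommGroup A]

/-- The average of `h` over the matrices with row sums `v`. -/
noncomputable def fiberMean (h : (ι → κ → A) → ℝ) (v : ι → A) : ℝ :=
  (∑ y ∈ rowSumFiber κ v, h y) / (rowSumFiber κ v).card

theorem rowSumFiber_nonempty (v : ι → A) : (rowSumFiber κ v).Nonempty := by
  rw [← Finset.card_pos, card_rowSumFiber v 0, Finset.card_pos]
  exact ⟨0, by rw [mem_rowSumFiber]; funext i; simp [rowSum]⟩

theorem abs_fiberMean_sub_le {i i' : ι} (hne : i ≠ i') (v : ι → A) (a : A)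
    (h : (ι → κ → A) → ℝ) (h0 : ∀ y, 0 ≤ h y) (h1 : ∀ y, h y ≤ 1)
    (hswap : ∀ i i' b y, h (swapOn i i' b y) = h y) :
    |fiberMean h v - fiberMean h (v + (Pi.single i' a - Pi.single i a))| ≤
      2 * √(Fintype.card A / 2 ^ Fintype.card κ) := by
  have hK : (0 : ℝ) < (rowSumFiber κ v).card := by
    exact_mod_cast (rowSumFiber_nonempty v).card_pos
  have := abs_sum_rowSumFiber_sub_le hne v a h h0 h1 (hswap i i')
  unfold fiberMean
  rw [card_rowSumFiber (κ := κ) (v + _) v, ← sub_div, abs_div, abs_of_pos hK, div_le_iff₀ hK]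
  linarith

/-- Telescoping: the values of the other users are handed to user `i` one at a time. This normal
form can then be compared with that of any other vector of the same total. -/
theorem abs_fiberMean_sub_single_le (i : ι) (v : ι → A)
    (h : (ι → κ → A) → ℝ) (h0 : ∀ y, 0 ≤ h y) (h1 : ∀ y, h y ≤ 1)
    (hswap : ∀ i i' b y, h (swapOn i i' b y) = h y) :
    |fiberMean h v - fiberMean h (Pi.single i (∑ k, v k))| ≤
      Fintype.card ι * (2 * √(Fintype.card A / 2 ^ Fintype.card κ)) := by
  set τ := 2 * √((Fintype.card A : ℝ) / 2 ^ Fintype.card κ) with hτ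
  have hτ0 : 0 ≤ τ := by positivity
  have key : ∀ s : Finset ι, i ∉ s →
      |fiberMean h v - fiberMean h (v + ∑ k ∈ s, (Pi.single i (v k) - Pi.single k (v k)))| ≤
        s.card * τ := by
    intro s
    induction s using Finset.induction_on with
    | empty => simp
    | insert k s hk ih =>
      intro hi
      rw [Finset.mem_insert, not_or] at hi
      rw [Finset.sum_insert hk, Finset.card_insert_of_notMem hk, add_comm (_ - _), ← add_assoc]
      refine (abs_sub_le _
        (fiberMean h (v + ∑ k ∈ s, (Pi.single i (v k) - Pi.single k (v k)))) _).trans ?_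
      have := abs_fiberMean_sub_le (Ne.symm hi.1)
        (v + ∑ k ∈ s, (Pi.single i (v k) - Pi.single k (v k))) (v k) h h0 h1 hswap
      push_cast
      linarith [ih hi.2]
  have hfin : v + ∑ k ∈ Finset.univ.erase i, (Pi.single i (v k) - Pi.single k (v k)) =
      Pi.single i (∑ k, v k) := by
    have hz : ∑ k, (Pi.single i (v k) - Pi.single k (v k) : ι → A) =
        ∑ k ∈ Finset.univ.erase i, (Pi.single i (v k) - Pi.single k (v k) : ι → A) := by
      rw [← Finset.add_sum_erase _ _ (Finset.mem_univ i), sub_self, zero_add]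
    rw [← hz, Finset.sum_sub_distrib, Finset.univ_sum_single]
    have : ∑ k, Pi.single i (v k) = (Pi.single i (∑ k, v k) : ι → A) :=
      (map_sum (AddMonoidHom.single (fun _ : ι => A) i) v Finset.univ).symm
    rw [this]
    abel
  have := key _ (Finset.notMem_erase i Finset.univ)
  rw [hfin] at this
  refine this.trans ?_
  gcongr
  exact Finset.card_le_univ _

theorem abs_fiberMean_sub_le_of_sum_eq (v w : ι → A) (hvw : ∑ k, v k = ∑ k, w k)
    (h : (ι → κ → A) → ℝ) (h0 : ∀ y, 0 ≤ h y) (h1 : ∀ y, h y ≤ 1)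
    (hswap : ∀ i i' b y, h (swapOn i i' b y) = h y) :
    |fiberMean h v - fiberMean h w| ≤
      4 * Fintype.card ι * √(Fintype.card A / 2 ^ Fintype.card κ) := by
  rcases isEmpty_or_nonempty ι with hι | ⟨⟨i⟩⟩
  · rw [Subsingleton.elim v w]
    simp
  · have hv := abs_fiberMean_sub_single_le i v h h0 h1 hswap
    have hw := abs_fiberMean_sub_single_le i w h h0 h1 hswap
    rw [abs_sub_comm, ← hvw] at hw
    refine (abs_sub_le _ (fiberMean h (Pi.single i (∑ k, v k))) _).trans ?_
    linarith

end FiberMean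

/-! ### Products of distributions -/

section Independent

variable {α β : Type*}

theorem tsum_prod_eq_prod_tsum {n : ℕ} (w : Fin n → α → ℝ≥0∞) :
    ∑' f : Fin n → α, ∏ i, w i (f i) = ∏ i, ∑' a, w i a := by
  induction n with
  | zero => simp
  | succ n ih =>
    rw [← (Fin.consEquiv (fun _ : Fin (n + 1) => α)).tsum_eq, ENNReal.tsum_prod']
    simp only [Fin.consEquiv_apply, Fin.prod_univ_succ, Fin.cons_zero, Fin.cons_succ,
      ENNReal.tsum_mul_left, ih (fun i => w i.succ), ENNReal.tsum_mul_right]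

theorem independent_apply {n : ℕ} (p : Fin n → PMF α) (f : Fin n → α) :
    independent p f = ∏ i, p i (f i) := rfl

theorem independent_bind {n : ℕ} (p : Fin n → PMF α) (k : Fin n → α → PMF β) :
    independent (fun i => (p i).bind (k i)) =
      (independent p).bind fun a => independent fun i => k i (a i) := by
  ext f
  simp only [independent_apply, PMF.bind_apply, ← Finset.prod_mul_distrib]
  exact (tsum_prod_eq_prod_tsum fun i a => p i a * k i a (f i)).symm

end Independent

/-! ### Additive secret sharing -/

section Share

variable {A : Type*} [Fintype A] [DecidableEq A] [AddCommGroup A]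

/-- Additive secret sharing: `m` uniformly random elements conditioned on summing to `v`. -/
noncomputable def share (m : ℕ) [NeZero m] (v : A) : PMF (Fin m → A) :=
  PMF.uniformOfFinset (Finset.univ.filter fun f => ∑ j, f j = v)
    (Finset.filter_nonempty_iff.2 ⟨Pi.single 0 v, by simp⟩)

theorem share_apply (m : ℕ) [NeZero m] (v : A) (f : Fin m → A) :
    share m v f = if ∑ j, f j = v then
      ((Finset.univ.filter fun f : Fin m → A => ∑ j, f j = v).card : ℝ≥0∞)⁻¹ else 0 := by
  simp [share, PMF.uniformOfFinset_apply]

/-- The set of matrices with given row sums is a product over the rows, so the product of the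
uniform laws is uniform on it. -/
theorem independent_share {n m : ℕ} [NeZero m] (v : Fin n → A) :
    independent (fun i => share m (v i)) =
      PMF.uniformOfFinset (rowSumFiber (Fin m) v) (rowSumFiber_nonempty v) := by
  have hpi : rowSumFiber (Fin m) v =
      Fintype.piFinset fun i => Finset.univ.filter fun f : Fin m → A => ∑ j, f j = v i := by
    ext y
    simp [mem_rowSumFiber, rowSum, funext_iff]
  ext y
  simp only [independent_apply, share_apply, PMF.uniformOfFinset_apply, mem_rowSumFiber]
  by_cases hy : rowSum y = v
  · have : ∀ i, ∑ j, y i j = v i := fun i => congrFun hy i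
    rw [if_pos hy, hpi, Fintype.card_piFinset]
    simp only [this, if_true]
    push_cast
    rw [ENNReal.prod_inv_distrib]
    intro i _ j _ _
    exact Or.inr (ENNReal.natCast_ne_top _)
  · rw [if_neg hy]
    obtain ⟨i, hi⟩ := Function.ne_iff.1 hy
    exact Finset.prod_eq_zero (Finset.mem_univ i) (if_neg hi)

theorem tsum_independent_share_mul {n m : ℕ} [NeZero m] (v : Fin n → A)
    (f : (Fin n → Fin m → A) → ℝ≥0∞) (hf : ∀ y, f y ≤ 1) :
    ∑' y, independent (fun i => share m (v i)) y * f y =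
      ENNReal.ofReal (fiberMean (fun y => (f y).toReal) v) := by
  have hne : ∀ y, f y ≠ ∞ := fun y => ((hf y).trans_lt ENNReal.one_lt_top).ne
  have hc : (0 : ℝ) < (rowSumFiber (Fin m) v).card := by
    exact_mod_cast (rowSumFiber_nonempty v).card_pos
  rw [independent_share, tsum_fintype]
  simp only [PMF.uniformOfFinset_apply, ite_mul, zero_mul]
  rw [← Finset.sum_filter, Finset.filter_mem_eq_inter, Finset.univ_inter, ← Finset.mul_sum,
    fiberMean, ENNReal.ofReal_div_of_pos hc, ENNReal.ofReal_natCast, ENNReal.div_eq_inv_mul,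
    ENNReal.ofReal_sum_of_nonneg fun y _ => ENNReal.toReal_nonneg]
  simp only [ENNReal.ofReal_toReal (hne _)]

theorem tsum_independent_share_le {n m : ℕ} [NeZero m] {v w : Fin n → A}
    (hvw : ∑ k, v k = ∑ k, w k) (f : (Fin n → Fin m → A) → ℝ≥0∞) (hf : ∀ y, f y ≤ 1)
    (hswap : ∀ i i' b y, f (swapOn i i' b y) = f y) :
    ∑' y, independent (fun i => share m (v i)) y * f y ≤
      ∑' y, independent (fun i => share m (w i)) y * f y +
        ENNReal.ofReal (4 * n * √(Fintype.card A / 2 ^ m)) := by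
  rw [tsum_independent_share_mul v f hf, tsum_independent_share_mul w f hf]
  have := abs_fiberMean_sub_le_of_sum_eq v w hvw (fun y => (f y).toReal)
    (fun y => ENNReal.toReal_nonneg)
    (fun y => by simpa using ENNReal.toReal_mono ENNReal.one_ne_top (hf y))
    (fun i i' b y => by rw [hswap])
  rw [Fintype.card_fin, Fintype.card_fin] at this
  refine (ENNReal.ofReal_le_ofReal ?_).trans ENNReal.ofReal_add_le
  linarith [le_abs_self (fiberMean (fun y => (f y).toReal) v - fiberMean (fun y => (f y).toReal) w)]

end Share

/-! ### Pólya variables and the divisibility of the geometric law -/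

section Polya

theorem multichoose_nonneg {r : ℝ} (hr : 0 ≤ r) (k : ℕ) : 0 ≤ Ring.multichoose r k := by
  have h : 0 ≤ (ascPochhammer ℕ k).smeval r := by
    induction k with
    | zero => simp
    | succ k ih =>
      rw [ascPochhammer_succ_right, Polynomial.smeval_mul, Polynomial.smeval_add,
        Polynomial.smeval_X, Polynomial.smeval_natCast]
      refine mul_nonneg ih ?_
      simp only [pow_one, pow_zero, nsmul_eq_mul, mul_one]
      positivity
  rw [← Ring.factorial_nsmul_multichoose_eq_ascPochhammer, nsmul_eq_mul] at h
  exact nonneg_of_mul_nonneg_right h (by positivity)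

/-- Chu–Vandermonde at `-r` and `-s`; the signs `(-1) ^ k` on the two sides agree and cancel. -/
theorem sum_antidiagonal_multichoose_mul (r s : ℝ) (k : ℕ) :
    ∑ ij ∈ Finset.HasAntidiagonal.antidiagonal k, Ring.multichoose r ij.1 * Ring.multichoose s ij.2 =
      Ring.multichoose (r + s) k := by
  have h := Ring.add_choose_eq k (Commute.all (-r) (-s))
  rw [← neg_add, Ring.choose_neg'] at h
  have h2 : ∑ ij ∈ Finset.HasAntidiagonal.antidiagonal k, Ring.choose (-r) ij.1 * Ring.choose (-s) ij.2 =
      Int.negOnePow k • ∑ ij ∈ Finset.HasAntidiagonal.antidiagonal k,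
        Ring.multichoose r ij.1 * Ring.multichoose s ij.2 := by
    rw [Finset.smul_sum]
    refine Finset.sum_congr rfl fun ij hij => ?_
    rw [Finset.HasAntidiagonal.mem_antidiagonal] at hij
    rw [Ring.choose_neg', Ring.choose_neg', ← hij, Nat.cast_add, Int.negOnePow_add,
      smul_mul_smul_comm]
  rw [h2] at h
  exact (smul_left_cancel _ h).symm

/-- The unnormalized weights of the Pólya (negative binomial) distribution. -/
noncomputable def polyaWeight (r α : ℝ) (k : ℕ) : ℝ≥0∞ :=
  ENNReal.ofReal (Ring.multichoose r k * α ^ k)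

theorem polyaWeight_zero (r α : ℝ) : polyaWeight r α 0 = 1 := by
  simp [polyaWeight]

theorem sum_antidiagonal_polyaWeight_mul {r s α : ℝ} (hr : 0 ≤ r) (hs : 0 ≤ s) (hα : 0 ≤ α)
    (k : ℕ) :
    ∑ ij ∈ Finset.HasAntidiagonal.antidiagonal k, polyaWeight r α ij.1 * polyaWeight s α ij.2 =
      polyaWeight (r + s) α k := by
  unfold polyaWeight
  rw [← sum_antidiagonal_multichoose_mul, Finset.sum_mul, ENNReal.ofReal_sum_of_nonneg]
  · refine Finset.sum_congr rfl fun ij hij => ?_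
    rw [Finset.HasAntidiagonal.mem_antidiagonal] at hij
    rw [← ENNReal.ofReal_mul (mul_nonneg (multichoose_nonneg hr _) (pow_nonneg hα _)), ← hij,
      pow_add]
    congr 1
    ring
  · intro ij _
    exact mul_nonneg (mul_nonneg (multichoose_nonneg hr _) (multichoose_nonneg hs _))
      (pow_nonneg hα _)

/-- The weights are the coefficients of `(1 - α * X) ^ (-r)`, so convolution adds the parameters
`r`. With `r = 1 / n` and `t = n` the parameter becomes `1`, the geometric case. -/
theorem tsum_prod_polyaWeight_mul {r α : ℝ} (hr : 0 ≤ r) (hα : 0 ≤ α) (t : ℕ)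
    (g : ℕ → ℝ≥0∞) :
    ∑' f : Fin t → ℕ, (∏ i, polyaWeight r α (f i)) * g (∑ i, f i) =
      ∑' s, polyaWeight (t * r) α s * g s := by
  induction t generalizing g with
  | zero =>
    rw [tsum_eq_single (0 : ℕ)]
    · simp [polyaWeight_zero]
    · intro b hb
      obtain ⟨c, rfl⟩ := Nat.exists_eq_succ_of_ne_zero hb
      simp [polyaWeight]
  | succ t ih =>
    rw [← (Fin.consEquiv (fun _ : Fin (t + 1) => ℕ)).tsum_eq, ENNReal.tsum_prod']
    simp only [Fin.consEquiv_apply, Fin.prod_univ_succ, Fin.sum_univ_succ, Fin.cons_zero,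
      Fin.cons_succ, mul_assoc, ENNReal.tsum_mul_left]
    simp only [fun a : ℕ => ih fun s => g (a + s), ← ENNReal.tsum_mul_left]
    rw [← ENNReal.tsum_prod, ← Finset.HasAntidiagonal.sigmaAntidiagonalEquivProd.tsum_eq, ENNReal.tsum_sigma']
    refine tsum_congr fun k => ?_
    rw [tsum_fintype, Finset.univ_eq_attach]
    have h1 : ((t + 1 : ℕ) : ℝ) * r = r + t * r := by push_cast; ring
    rw [h1, ← sum_antidiagonal_polyaWeight_mul hr (by positivity) hα, Finset.sum_mul,
      ← Finset.sum_attach (Finset.HasAntidiagonal.antidiagonal k)]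
    refine Finset.sum_congr rfl fun ij _ => ?_
    have := Finset.HasAntidiagonal.mem_antidiagonal.1 ij.2
    simp [this, mul_assoc]

theorem tsum_polyaWeight_one {α : ℝ} (hα : 0 ≤ α) (hα1 : α < 1) :
    ∑' s, polyaWeight 1 α s = ENNReal.ofReal (1 - α)⁻¹ := by
  simp only [polyaWeight, Ring.multichoose_one, one_mul]
  rw [← ENNReal.ofReal_tsum_of_nonneg (fun s => pow_nonneg hα s)
    (summable_geometric_of_lt_one hα hα1), tsum_geometric_of_lt_one hα hα1]

theorem tsum_polyaWeight_pow {α : ℝ} (hα : 0 ≤ α) (hα1 : α < 1) {n : ℕ} (hn : n ≠ 0) :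
    (∑' k, polyaWeight (1 / n) α k) ^ n = ENNReal.ofReal (1 - α)⁻¹ := by
  have h := tsum_prod_polyaWeight_mul (r := 1 / n) (by positivity) hα n fun _ => 1
  have hn' : (n : ℝ) ≠ 0 := by exact_mod_cast hn
  simp only [mul_one, mul_one_div_cancel hn', tsum_polyaWeight_one hα hα1] at h
  rw [← h, tsum_prod_eq_prod_tsum fun _ : Fin n => polyaWeight (1 / n) α]
  simp

theorem tsum_polyaWeight_ne_zero (r α : ℝ) : ∑' k, polyaWeight r α k ≠ 0 := by
  rw [Ne, ENNReal.tsum_eq_zero]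
  intro h
  simpa [polyaWeight_zero] using h 0

/-- Finiteness comes for free: the `n`-th power of the sum is a geometric series. -/
theorem tsum_polyaWeight_ne_top {α : ℝ} (hα : 0 ≤ α) (hα1 : α < 1) {n : ℕ} (hn : n ≠ 0) :
    ∑' k, polyaWeight (1 / n) α k ≠ ∞ := by
  intro h
  have := tsum_polyaWeight_pow hα hα1 hn
  rw [h, ENNReal.top_pow hn] at this
  exact ENNReal.ofReal_ne_top this.symm

/-- The Pólya distribution, whose `n`-fold convolution power is geometric. -/
noncomputable def polya {α : ℝ} (hα : 0 ≤ α) (hα1 : α < 1) {n : ℕ} (hn : n ≠ 0) : PMF ℕ :=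
  PMF.normalize (polyaWeight (1 / n) α) (tsum_polyaWeight_ne_zero _ _)
    (tsum_polyaWeight_ne_top hα hα1 hn)

/-- The weights of the geometric distribution. -/
noncomputable def geomWeight (α : ℝ) (s : ℕ) : ℝ≥0∞ := ENNReal.ofReal ((1 - α) * α ^ s)

theorem tsum_prod_polya_mul {α : ℝ} (hα : 0 ≤ α) (hα1 : α < 1) {n : ℕ} (hn : n ≠ 0)
    (g : ℕ → ℝ≥0∞) :
    ∑' f : Fin n → ℕ, (∏ i, polya hα hα1 hn (f i)) * g (∑ i, f i) =
      ∑' s, geomWeight α s * g s := by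
  have hn' : (n : ℝ) ≠ 0 := by exact_mod_cast hn
  have hc : ((∑' k, polyaWeight (1 / n) α k)⁻¹) ^ n = ENNReal.ofReal (1 - α) := by
    rw [← ENNReal.inv_pow, tsum_polyaWeight_pow hα hα1 hn,
      ← ENNReal.ofReal_inv_of_pos (inv_pos.2 (sub_pos.2 hα1)), inv_inv]
  simp only [polya, PMF.normalize_apply, Finset.prod_mul_distrib, Finset.prod_const,
    Finset.card_univ, Fintype.card_fin, hc]
  simp only [mul_comm _ (ENNReal.ofReal (1 - α)), mul_assoc, ENNReal.tsum_mul_left]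
  rw [tsum_prod_polyaWeight_mul (by positivity) hα, mul_one_div_cancel hn',
    ← ENNReal.tsum_mul_left]
  refine tsum_congr fun s => ?_
  rw [geomWeight, ENNReal.ofReal_mul (sub_pos.2 hα1).le, polyaWeight, Ring.multichoose_one,
    one_mul, mul_assoc]

/-- A pair of independent Pólya variables. -/
noncomputable def polyaPair {α : ℝ} (hα : 0 ≤ α) (hα1 : α < 1) {n : ℕ} (hn : n ≠ 0) :
    PMF (ℕ × ℕ) :=
  (polya hα hα1 hn).bind fun s => (polya hα hα1 hn).bind fun t => PMF.pure (s, t)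

theorem polyaPair_apply {α : ℝ} (hα : 0 ≤ α) (hα1 : α < 1) {n : ℕ} (hn : n ≠ 0) (u : ℕ × ℕ) :
    polyaPair hα hα1 hn u = polya hα hα1 hn u.1 * polya hα hα1 hn u.2 := by
  obtain ⟨s, t⟩ := u
  simp only [polyaPair, PMF.bind_apply, PMF.pure_apply, Prod.mk.injEq]
  rw [tsum_eq_single s, tsum_eq_single t]
  · simp
  · intro t' ht
    simp [ht.symm]
  · intro s' hs
    simp [hs.symm]

theorem tsum_prod_polyaPair_mul {α : ℝ} (hα : 0 ≤ α) (hα1 : α < 1) {n : ℕ} (hn : n ≠ 0)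
    (g : ℕ → ℕ → ℝ≥0∞) :
    ∑' ν : Fin n → ℕ × ℕ, (∏ i, polyaPair hα hα1 hn (ν i)) *
        g (∑ i, (ν i).1) (∑ i, (ν i).2) =
      ∑' s, geomWeight α s * ∑' t, geomWeight α t * g s t := by
  rw [← (Equiv.arrowProdEquivProdArrow (Fin n) (fun _ => ℕ) (fun _ => ℕ)).symm.tsum_eq,
    ENNReal.tsum_prod']
  simp only [polyaPair_apply, Finset.prod_mul_distrib, mul_assoc, ENNReal.tsum_mul_left,
    Equiv.arrowProdEquivProdArrow_symm_apply]
  simp only [fun s => tsum_prod_polya_mul hα hα1 hn (g s)]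
  exact tsum_prod_polya_mul hα hα1 hn fun s => ∑' t, geomWeight α t * g s t

end Polya

/-! ### Discrete Laplace noise: shifts and second moment -/

section Geometric

variable {α : ℝ}

theorem geomWeight_succ (hα : 0 ≤ α) (s : ℕ) :
    geomWeight α (s + 1) = ENNReal.ofReal α * geomWeight α s := by
  rw [geomWeight, geomWeight, ← ENNReal.ofReal_mul hα]
  congr 1
  ring

/-- The weights shrink by the factor `α` per step, so the left side is the right side without its
term at `0`. Used in the positive variable it handles the shift by `-1`, in the negative one the
shift by `+1`. -/
theorem ofReal_mul_tsum_geomWeight_le (hα : 0 ≤ α) (g : ℕ → ℝ≥0∞) :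
    ENNReal.ofReal α * ∑' s, geomWeight α s * g (s + 1) ≤ ∑' s, geomWeight α s * g s := by
  rw [tsum_eq_zero_add' (f := fun s => geomWeight α s * g s) ENNReal.summable,
    ← ENNReal.tsum_mul_left]
  refine le_add_left (le_of_eq (tsum_congr fun s => ?_))
  rw [geomWeight_succ hα, mul_assoc]

theorem tsum_geomWeight (hα : 0 ≤ α) (hα1 : α < 1) : ∑' s, geomWeight α s = 1 := by
  have h : ∀ s, geomWeight α s = ENNReal.ofReal (1 - α) * polyaWeight 1 α s := by
    intro s
    rw [geomWeight, ENNReal.ofReal_mul (sub_pos.2 hα1).le, polyaWeight, Ring.multichoose_one,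
      one_mul]
  have h0 : 0 < 1 - α := sub_pos.2 hα1
  simp only [h, ENNReal.tsum_mul_left, tsum_polyaWeight_one hα hα1]
  rw [← ENNReal.ofReal_mul h0.le, mul_inv_cancel₀ h0.ne', ENNReal.ofReal_one]

/-- The expectation of `g` under the law of the difference of two independent geometric
variables. -/
noncomputable def discreteLaplaceMean {A : Type*} [AddGroupWithOne A] (α : ℝ)
    (g : A → ℝ≥0∞) : ℝ≥0∞ :=
  ∑' s, geomWeight α s * ∑' t, geomWeight α t * g ((s : A) - (t : A))

variable {A : Type*} [AddCommGroupWithOne A]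

theorem ofReal_mul_discreteLaplaceMean_le_sub_one (hα : 0 ≤ α) (g : A → ℝ≥0∞) :
    ENNReal.ofReal α * discreteLaplaceMean α g ≤ discreteLaplaceMean α fun z => g (z - 1) := by
  refine le_trans (le_of_eq ?_) (ofReal_mul_tsum_geomWeight_le hα _)
  unfold discreteLaplaceMean
  congr 1
  refine tsum_congr fun s => ?_
  congr 1
  refine tsum_congr fun t => ?_
  congr 2
  push_cast
  abel

theorem ofReal_mul_discreteLaplaceMean_le_add_one (hα : 0 ≤ α) (g : A → ℝ≥0∞) :
    ENNReal.ofReal α * discreteLaplaceMean α g ≤ discreteLaplaceMean α fun z => g (z + 1) := by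
  unfold discreteLaplaceMean
  rw [← ENNReal.tsum_mul_left]
  refine ENNReal.tsum_le_tsum fun s => ?_
  rw [mul_left_comm]
  gcongr
  refine le_trans (le_of_eq ?_) (ofReal_mul_tsum_geomWeight_le hα _)
  congr 1
  refine tsum_congr fun t => ?_
  congr 2
  push_cast
  abel

theorem ofReal_pow_mul_discreteLaplaceMean_le (hα : 0 ≤ α) (d : ℕ)
    (g : A → ℝ≥0∞) :
    ENNReal.ofReal α ^ d * discreteLaplaceMean α g ≤ discreteLaplaceMean α (fun z => g (z + d)) ∧
    ENNReal.ofReal α ^ d * discreteLaplaceMean α g ≤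
      discreteLaplaceMean α fun z => g (z - d) := by
  induction d with
  | zero => simp
  | succ d ih =>
    constructor
    · calc ENNReal.ofReal α ^ (d + 1) * discreteLaplaceMean α g
          = ENNReal.ofReal α * (ENNReal.ofReal α ^ d * discreteLaplaceMean α g) := by ring
        _ ≤ ENNReal.ofReal α * discreteLaplaceMean α (fun z => g (z + d)) := by
            gcongr; exact ih.1
        _ ≤ _ := ofReal_mul_discreteLaplaceMean_le_add_one hα _
        _ = _ := by simp only [Nat.cast_add, Nat.cast_one, add_assoc, add_comm (1 : A)]
    · calc ENNReal.ofReal α ^ (d + 1) * discreteLaplaceMean α g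
          = ENNReal.ofReal α * (ENNReal.ofReal α ^ d * discreteLaplaceMean α g) := by ring
        _ ≤ ENNReal.ofReal α * discreteLaplaceMean α (fun z => g (z - d)) := by
            gcongr; exact ih.2
        _ ≤ _ := ofReal_mul_discreteLaplaceMean_le_sub_one hα _
        _ = _ := by simp only [Nat.cast_add, Nat.cast_one, sub_sub, add_comm (1 : A)]

theorem ofReal_pow_mul_discreteLaplaceMean_le_intCast (hα : 0 ≤ α) (hα1 : α < 1) {n : ℕ} {d : ℤ}
    (hd : d.natAbs ≤ n) (g : A → ℝ≥0∞) :
    ENNReal.ofReal α ^ n * discreteLaplaceMean α g ≤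
      discreteLaplaceMean α fun z => g (z + d) := by
  obtain ⟨k, hk⟩ := Int.eq_nat_or_neg d
  have hkn : k ≤ n := by omega
  have h : ENNReal.ofReal α ^ n ≤ ENNReal.ofReal α ^ k :=
    pow_le_pow_right_of_le_one' (ENNReal.ofReal_le_one.2 hα1.le) hkn
  refine (mul_le_mul_left h _).trans ?_
  have := ofReal_pow_mul_discreteLaplaceMean_le hα k g
  rcases hk with rfl | rfl
  · simpa using this.1
  · simpa [sub_eq_add_neg] using this.2

theorem tsum_geomWeight_mul_sq_le (hα : 0 ≤ α) (hα1 : α < 1) :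
    ∑' s, geomWeight α s * ENNReal.ofReal ((s : ℝ) ^ 2) ≤ ENNReal.ofReal (2 / (1 - α) ^ 2) := by
  have h0 : 0 < 1 - α := sub_pos.2 hα1
  have hnorm : ‖α‖ < 1 := by rwa [Real.norm_of_nonneg hα]
  have hs := (summable_choose_mul_geometric_of_norm_lt_one 2 hnorm).mul_left (2 * (1 - α))
  have ht := tsum_choose_mul_geometric_of_norm_lt_one 2 hnorm
  -- `s ^ 2 ≤ 2 * (s + 2).choose 2`, and the binomial series sums to `1 / (1 - α) ^ 3`.
  have hle : ∀ s : ℕ, geomWeight α s * ENNReal.ofReal ((s : ℝ) ^ 2) ≤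
      ENNReal.ofReal (2 * (1 - α) * (((s + 2).choose 2 : ℕ) * α ^ s)) := by
    intro s
    rw [geomWeight, ← ENNReal.ofReal_mul (by positivity)]
    refine ENNReal.ofReal_le_ofReal ?_
    rw [Nat.cast_choose_two]
    push_cast
    have : 0 ≤ (1 - α) * α ^ s := by positivity
    have hs0 : (0 : ℝ) ≤ s := Nat.cast_nonneg s
    nlinarith [mul_nonneg this hs0]
  refine (ENNReal.tsum_le_tsum hle).trans ?_
  rw [← ENNReal.ofReal_tsum_of_nonneg (fun s => by positivity) hs, tsum_mul_left, ht]
  refine ENNReal.ofReal_le_ofReal (le_of_eq ?_)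
  field_simp

end Geometric

/-! ### Expectations under `PMF` operations -/

section PMFLemmas

variable {α β : Type*}

theorem tsum_bind_mul (p : PMF α) (k : α → PMF β) (g : β → ℝ≥0∞) :
    ∑' b, (p.bind k) b * g b = ∑' a, p a * ∑' b, k a b * g b := by
  simp only [PMF.bind_apply, ← ENNReal.tsum_mul_right, ← ENNReal.tsum_mul_left]
  rw [ENNReal.tsum_comm]
  simp only [mul_assoc]

theorem tsum_pure_mul (a : α) (g : α → ℝ≥0∞) : ∑' b, PMF.pure a b * g b = g a := by
  rw [tsum_eq_single a]
  · simp
  · intro b hb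
    simp [PMF.pure_apply, hb]

theorem tsum_map_mul (p : PMF α) (f : α → β) (g : β → ℝ≥0∞) :
    ∑' b, (p.map f) b * g b = ∑' a, p a * g (f a) := by
  rw [← PMF.bind_pure_comp, tsum_bind_mul]
  simp only [Function.comp_apply, tsum_pure_mul]

theorem toOuterMeasure_eq_tsum (p : PMF α) (E : Set α) :
    p.toOuterMeasure E = ∑' a, p a * E.indicator 1 a := by
  rw [PMF.toOuterMeasure_apply]
  refine tsum_congr fun a => ?_
  by_cases ha : a ∈ E <;> simp [ha]

theorem tsum_mul_le_one (p : PMF α) {g : α → ℝ≥0∞} (hg : ∀ a, g a ≤ 1) :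
    ∑' a, p a * g a ≤ 1 := by
  rw [← p.tsum_coe]
  exact ENNReal.tsum_le_tsum fun a => mul_le_of_le_one_right' (hg a)

theorem map_uniformOfFintype_equiv [Fintype α] [Nonempty α] (e : α ≃ α) :
    (PMF.uniformOfFintype α).map e = PMF.uniformOfFintype α := by
  classical
  ext a
  rw [PMF.map_apply, tsum_eq_single (e.symm a)]
  · simp
  · intro b hb
    rw [if_neg]
    rintro rfl
    simp at hb

end PMFLemmas

/-! ### Both shuffling models share the two properties needed -/

section Shufflers

variable {Y : Type*} {n m : ℕ}

/-- Permute the messages in each column by its own uniformly random permutation. -/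
noncomputable def parallelShuffle (y : Fin n → Fin m → Y) : PMF (Fin m → Fin n → Y) :=
  (PMF.uniformOfFintype (Fin m → Equiv.Perm (Fin n))).map fun π j i => y (π j i) j

/-- Permute all messages together by a uniformly random permutation. -/
noncomputable def singleShuffle (y : Fin n → Fin m → Y) : PMF (Fin m → Fin n → Y) :=
  (PMF.uniformOfFintype (Equiv.Perm (Fin m × Fin n))).map fun π j i =>
    y (π (j, i)).2 (π (j, i)).1

/-- The properties of a shuffling stage used in the analysis: its output law does not change if
two users exchange some of their messages, and it preserves the sum of all messages. -/
structure IsShuffler [AddCommMonoid Y]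
    (H : (Fin n → Fin m → Y) → PMF (Fin m → Fin n → Y)) : Prop where
  swapOn : ∀ i i' b y, H (swapOn i i' b y) = H y
  sum : ∀ y (g : Y → ℝ≥0∞), ∑' z, H y z * g (∑ j, ∑ i, z j i) = g (∑ i, ∑ j, y i j)

theorem isShuffler_parallelShuffle [AddCommMonoid Y] :
    IsShuffler (parallelShuffle : (Fin n → Fin m → Y) → PMF (Fin m → Fin n → Y)) where
  swapOn i i' b y := by
    let τ : Fin m → Equiv.Perm (Fin n) := fun j => if j ∈ b then Equiv.swap i i' else 1
    unfold parallelShuffle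
    conv_rhs => rw [← map_uniformOfFintype_equiv (Equiv.mulLeft τ), PMF.map_comp]
    congr 1
    funext π j k
    simp only [Shuffle.swapOn, Function.comp_apply, Equiv.coe_mulLeft, Pi.mul_apply,
      Equiv.Perm.mul_apply, τ]
    split_ifs <;> rfl
  sum y g := by
    rw [parallelShuffle, tsum_map_mul]
    have h : ∀ π : Fin m → Equiv.Perm (Fin n), ∑ j, ∑ i, y (π j i) j = ∑ i, ∑ j, y i j := by
      intro π
      rw [Finset.sum_comm (f := fun i j => y i j)]
      exact Finset.sum_congr rfl fun j _ => Equiv.sum_comp (π j) fun i => y i j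
    simp only [h, ENNReal.tsum_mul_right, PMF.tsum_coe, one_mul]

theorem isShuffler_singleShuffle [AddCommMonoid Y] :
    IsShuffler (singleShuffle : (Fin n → Fin m → Y) → PMF (Fin m → Fin n → Y)) where
  swapOn i i' b y := by
    let τ : Equiv.Perm (Fin m × Fin n) := Equiv.prodShear (Equiv.refl (Fin m))
      fun j => if j ∈ b then Equiv.swap i i' else 1
    unfold singleShuffle
    conv_rhs => rw [← map_uniformOfFintype_equiv (Equiv.mulLeft τ), PMF.map_comp]
    congr 1
    funext π j k
    simp only [Shuffle.swapOn, Function.comp_apply, Equiv.coe_mulLeft, Equiv.Perm.mul_apply, τ,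
      Equiv.prodShear_apply, Equiv.refl_apply]
    split_ifs <;> rfl
  sum y g := by
    rw [singleShuffle, tsum_map_mul]
    have h : ∀ π : Equiv.Perm (Fin m × Fin n),
        ∑ j, ∑ i, y (π (j, i)).2 (π (j, i)).1 = ∑ i, ∑ j, y i j := by
      intro π
      rw [Finset.sum_comm (f := fun i j => y i j), ← Fintype.sum_prod_type',
        ← Fintype.sum_prod_type']
      exact Equiv.sum_comp π fun u => y u.2 u.1
    simp only [h, ENNReal.tsum_mul_right, PMF.tsum_coe, one_mul]

end Shufflers

/-! ### Privacy of shuffled noisy shares -/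

section NoisyShares

variable {X A : Type*} [Fintype A] [DecidableEq A] [AddCommGroupWithOne A] {n m : ℕ} [NeZero m]

/-- Add a difference of two Pólya variables to the encoding of the input and split the result
into additive shares. -/
noncomputable def noisyShare (m : ℕ) [NeZero m] {α : ℝ} (hα : 0 ≤ α) (hα1 : α < 1) (hn : n ≠ 0)
    (c : X → A) (x : X) : PMF (Fin m → A) :=
  (polyaPair hα hα1 hn).bind fun u => share m (c x + ((u.1 : A) - (u.2 : A)))

variable {α : ℝ} (hα : 0 ≤ α) (hα1 : α < 1) (hn : n ≠ 0) (c : X → A)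
  {H : (Fin n → Fin m → A) → PMF (Fin m → Fin n → A)}

theorem tsum_noisyShare_bind_mul (x : Fin n → X) (g : (Fin m → Fin n → A) → ℝ≥0∞) :
    ∑' z, ((independent fun i => noisyShare m hα hα1 hn c (x i)).bind H) z * g z =
      ∑' ν : Fin n → ℕ × ℕ, (∏ i, polyaPair hα hα1 hn (ν i)) *
        ∑' y, independent (fun i => share m (c (x i) + (((ν i).1 : A) - ((ν i).2 : A)))) y *
          ∑' z, H y z * g z := by
  rw [tsum_bind_mul]
  unfold noisyShare
  rw [independent_bind (fun _ => polyaPair hα hα1 hn)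
    fun i u => share m (c (x i) + ((u.1 : A) - (u.2 : A))), tsum_bind_mul]
  rfl

theorem sum_add_sub_cast (x : Fin n → X) (ν : Fin n → ℕ × ℕ) :
    ∑ i, (c (x i) + (((ν i).1 : A) - ((ν i).2 : A))) =
      ∑ i, c (x i) + (((∑ i, (ν i).1 : ℕ) : A) - ((∑ i, (ν i).2 : ℕ) : A)) := by
  simp [Finset.sum_add_distrib]

theorem tsum_independent_share_mul_sum (v : Fin n → A) (k : A → ℝ≥0∞) :
    ∑' y, independent (fun i => share m (v i)) y * k (∑ i, ∑ j, y i j) = k (∑ i, v i) := by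
  have h : ∀ y, independent (fun i => share m (v i)) y * k (∑ i, ∑ j, y i j) =
      independent (fun i => share m (v i)) y * k (∑ i, v i) := by
    intro y
    by_cases hy : rowSum y = v
    · have : ∑ i, ∑ j, y i j = ∑ i, v i := by rw [← hy]; rfl
      rw [this]
    · rw [independent_share, PMF.uniformOfFinset_apply, if_neg (by rwa [mem_rowSumFiber]),
        zero_mul, zero_mul]
  simp only [h, ENNReal.tsum_mul_right, PMF.tsum_coe, one_mul]

theorem tsum_noisyShare_bind_mul_sum (hH : IsShuffler H) (x : Fin n → X) (k : A → ℝ≥0∞) :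
    ∑' z, ((independent fun i => noisyShare m hα hα1 hn c (x i)).bind H) z *
        k (∑ j, ∑ i, z j i) =
      discreteLaplaceMean α fun z => k (∑ i, c (x i) + z) := by
  rw [tsum_noisyShare_bind_mul]
  simp only [hH.sum, tsum_independent_share_mul_sum, sum_add_sub_cast]
  exact tsum_prod_polyaPair_mul hα hα1 hn fun s t => k (∑ i, c (x i) + ((s : A) - (t : A)))

/-- Up to a small additive error, the probability of an event is the mean of a function of the
noisy sum of the encoded inputs; the function does not depend on the inputs. -/
theorem exists_discreteLaplaceMean_near (hH : IsShuffler H) (E : Set (Fin m → Fin n → A)) :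
    ∃ Ψ : A → ℝ≥0∞, ∀ x : Fin n → X,
      ((independent fun i => noisyShare m hα hα1 hn c (x i)).bind H).toOuterMeasure E ≤
        discreteLaplaceMean α (fun z => Ψ (∑ i, c (x i) + z)) +
          ENNReal.ofReal (4 * n * √(Fintype.card A / 2 ^ m)) ∧
      discreteLaplaceMean α (fun z => Ψ (∑ i, c (x i) + z)) ≤
        ((independent fun i => noisyShare m hα hα1 hn c (x i)).bind H).toOuterMeasure E +
          ENNReal.ofReal (4 * n * √(Fintype.card A / 2 ^ m)) := by
  set τ := ENNReal.ofReal (4 * n * √(Fintype.card A / 2 ^ m)) with hτ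
  let F : (Fin n → Fin m → A) → ℝ≥0∞ := fun y => ∑' z, H y z * E.indicator 1 z
  have hF1 : ∀ y, F y ≤ 1 := fun y => tsum_mul_le_one _ fun z => by
    by_cases hz : z ∈ E <;> simp [hz]
  have hFs : ∀ i i' b y, F (swapOn i i' b y) = F y := fun i i' b y => by
    simp only [F, hH.swapOn]
  let Φ : (Fin n → A) → ℝ≥0∞ := fun v => ∑' y, independent (fun i => share m (v i)) y * F y
  let i₀ : Fin n := ⟨0, Nat.pos_of_ne_zero hn⟩
  -- `Ψ s` is the probability of `E` when one fixed user shares `s` and all others share `0`.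
  let Ψ : A → ℝ≥0∞ := fun s => Φ (Pi.single i₀ s)
  have hsum : ∀ v : Fin n → A, ∑ k, v k = ∑ k, (Pi.single i₀ (∑ i, v i) : Fin n → A) k := by
    intro v; simp
  have hΦ : ∀ v, Φ v ≤ Ψ (∑ i, v i) + τ := fun v =>
    tsum_independent_share_le (hsum v) F hF1 hFs
  have hΨ : ∀ v, Ψ (∑ i, v i) ≤ Φ v + τ := fun v =>
    tsum_independent_share_le (hsum v).symm F hF1 hFs
  have hone : ∑' ν : Fin n → ℕ × ℕ, ∏ i, polyaPair hα hα1 hn (ν i) = 1 :=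
    tsum_prod_fin n fun _ => polyaPair hα hα1 hn
  refine ⟨Ψ, fun x => ?_⟩
  have hmean : discreteLaplaceMean α (fun z => Ψ (∑ i, c (x i) + z)) =
      ∑' ν : Fin n → ℕ × ℕ, (∏ i, polyaPair hα hα1 hn (ν i)) *
        Ψ (∑ i, (c (x i) + (((ν i).1 : A) - ((ν i).2 : A)))) := by
    simp only [sum_add_sub_cast]
    exact (tsum_prod_polyaPair_mul hα hα1 hn
      fun s t => Ψ (∑ i, c (x i) + ((s : A) - (t : A)))).symm
  rw [hmean, toOuterMeasure_eq_tsum, tsum_noisyShare_bind_mul]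
  constructor
  · calc
      _ ≤ ∑' ν : Fin n → ℕ × ℕ, (∏ i, polyaPair hα hα1 hn (ν i)) *
          (Ψ (∑ i, (c (x i) + (((ν i).1 : A) - ((ν i).2 : A)))) + τ) := by
        refine ENNReal.tsum_le_tsum fun ν => mul_le_mul_right ?_ _
        exact hΦ fun i => c (x i) + (((ν i).1 : A) - ((ν i).2 : A))
      _ = _ := by simp only [mul_add, ENNReal.tsum_add, ENNReal.tsum_mul_right, hone, one_mul]
  · calc
      _ ≤ ∑' ν : Fin n → ℕ × ℕ, (∏ i, polyaPair hα hα1 hn (ν i)) *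
          (Φ (fun i => c (x i) + (((ν i).1 : A) - ((ν i).2 : A))) + τ) := by
        refine ENNReal.tsum_le_tsum fun ν => mul_le_mul_right ?_ _
        exact hΨ fun i => c (x i) + (((ν i).1 : A) - ((ν i).2 : A))
      _ = _ := by simp only [mul_add, ENNReal.tsum_add, ENNReal.tsum_mul_right, hone, one_mul]; rfl

/-- Passing to the noisy total and back costs `τ` twice, with the shift factor `exp (-ε)` in
between. Multiplying through by `exp ε` gives the additive error `(1 + exp ε) * τ`. -/
theorem isDP_noisyShare_bind (hH : IsShuffler H) {d : X → ℕ} (hd : ∀ x, d x ≤ n) {ε δ : ℝ}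
    (hε : α ^ n = Real.exp (-ε))
    (hδ : (1 + Real.exp ε) * (4 * n * √(Fintype.card A / 2 ^ m)) ≤ δ) :
    IsDP ε δ fun x : Fin n → X =>
      (independent fun i => noisyShare m hα hα1 hn (fun x => (d x : A)) (x i)).bind H := by
  intro x x' hxx' E
  obtain ⟨Ψ, hΨ⟩ := exists_discreteLaplaceMean_near hα hα1 hn (fun x => (d x : A)) hH E
  set τ : ℝ := 4 * n * √(Fintype.card A / 2 ^ m) with hτ
  have hτ0 : 0 ≤ τ := by positivity
  set P := ((independent fun i => noisyShare m hα hα1 hn (fun x => (d x : A)) (x i)).bind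
    H).toOuterMeasure E with hP
  set P' := ((independent fun i => noisyShare m hα hα1 hn (fun x => (d x : A)) (x' i)).bind
    H).toOuterMeasure E with hP'
  have hle1 : ∀ p : PMF (Fin m → Fin n → A), p.toOuterMeasure E ≠ ∞ := fun p => by
    refine ((?_ : p.toOuterMeasure E ≤ 1).trans_lt ENNReal.one_lt_top).ne
    rw [toOuterMeasure_eq_tsum]
    exact tsum_mul_le_one _ fun z => by by_cases hz : z ∈ E <;> simp [hz]
  obtain ⟨i, hi⟩ := hxx'
  set k : ℤ := (d (x' i) : ℤ) - d (x i) with hk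
  have hkn : k.natAbs ≤ n := by
    have := hd (x i)
    have := hd (x' i)
    omega
  have hsum : ∑ l, (d (x' l) : A) = ∑ l, (d (x l) : A) + (k : A) := by
    rw [← Finset.add_sum_erase _ (fun l => (d (x' l) : A)) (Finset.mem_univ i),
      ← Finset.add_sum_erase _ (fun l => (d (x l) : A)) (Finset.mem_univ i),
      Finset.sum_congr rfl fun l hl => by rw [← hi l (Finset.ne_of_mem_erase hl)]]
    rw [hk]
    push_cast
    abel
  have hshift := ofReal_pow_mul_discreteLaplaceMean_le_intCast hα hα1 hkn
    fun z : A => Ψ (∑ l, (d (x l) : A) + z)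
  have hrw : ∀ z : A, ∑ l, (d (x l) : A) + (z + (k : A)) = ∑ l, (d (x' l) : A) + z := by
    intro z
    rw [hsum]; abel
  simp only [hrw] at hshift
  rw [← ENNReal.ofReal_pow hα, hε] at hshift
  have hmain : ENNReal.ofReal (Real.exp (-ε)) * P ≤
      P' + ENNReal.ofReal τ + ENNReal.ofReal (Real.exp (-ε)) * ENNReal.ofReal τ := by
    calc ENNReal.ofReal (Real.exp (-ε)) * P
        ≤ ENNReal.ofReal (Real.exp (-ε)) * (discreteLaplaceMean α
            (fun z => Ψ (∑ l, (d (x l) : A) + z)) + ENNReal.ofReal τ) := by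
          gcongr
          exact (hΨ x).1
      _ ≤ _ := by
          rw [mul_add]
          gcongr
          exact hshift.trans (hΨ x').2
  have hfin1 : P' + ENNReal.ofReal τ ≠ ∞ := ENNReal.add_ne_top.2 ⟨hle1 _, ENNReal.ofReal_ne_top⟩
  have hfin2 : ENNReal.ofReal (Real.exp (-ε)) * ENNReal.ofReal τ ≠ ∞ :=
    ENNReal.mul_ne_top ENNReal.ofReal_ne_top ENNReal.ofReal_ne_top
  have hreal := ENNReal.toReal_mono (ENNReal.add_ne_top.2 ⟨hfin1, hfin2⟩) hmain
  rw [ENNReal.toReal_add hfin1 hfin2, ENNReal.toReal_add (hle1 _) ENNReal.ofReal_ne_top, ENNReal.toReal_mul, ENNReal.toReal_mul,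
    ENNReal.toReal_ofReal (Real.exp_pos _).le, ENNReal.toReal_ofReal hτ0] at hreal
  have hmul := mul_le_mul_of_nonneg_left hreal (Real.exp_pos ε).le
  have hee : Real.exp ε * Real.exp (-ε) = 1 := by rw [← Real.exp_add]; simp
  have h1 : Real.exp ε * (Real.exp (-ε) * P.toReal) = P.toReal := by rw [← mul_assoc, hee, one_mul]
  have h2 : Real.exp ε * (P'.toReal + τ + Real.exp (-ε) * τ) =
      Real.exp ε * P'.toReal + (1 + Real.exp ε) * τ := by
    have : Real.exp ε * (Real.exp (-ε) * τ) = τ := by rw [← mul_assoc, hee, one_mul]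
    rw [mul_add, this]; ring
  rw [h1, h2] at hmul
  linarith

end NoisyShares

/-! ### Decoding error and rounding error -/

section Accuracy

/-- Without wraparound the error is exactly `|k|`. Wraparound forces `|k| ≥ N ≥ T`, and the minimal
representative is at most `|T + k|` in size, so the error is at most `2 * T + |k| ≤ 3 * |k|`. The
modulus `4 * N` is chosen for this, and large noise needs no separate tail bound. -/
theorem abs_valMinAbs_sub_le {N T k : ℤ} {q : ℕ} [NeZero q] (hq : (q : ℤ) = 4 * N) (hT : 0 ≤ T)
    (hTN : T ≤ N) : |((T + k : ℤ) : ZMod q).valMinAbs - T| ≤ 3 * |k| := by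
  by_cases h : (T + k) * 2 ∈ Set.Ioc (-(q : ℤ)) q
  · rw [(ZMod.valMinAbs_spec _ _).2 ⟨rfl, h⟩, add_sub_cancel_left]
    linarith [abs_nonneg k]
  · have h1 := ZMod.natAbs_min_of_le_div_two q (((T + k : ℤ) : ZMod q).valMinAbs) (T + k)
      (by simp) (ZMod.natAbs_valMinAbs_le _)
    rw [Set.mem_Ioc] at h
    generalize ((T + k : ℤ) : ZMod q).valMinAbs = w at *
    rw [Int.abs_eq_natAbs, Int.abs_eq_natAbs]
    omega

theorem sq_decode_sub_le {n : ℕ} (hn : n ≠ 0) {q : ℕ} [NeZero q] (hq : q = 4 * n ^ 2)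
    (x : Fin n → Set.Icc (0 : ℝ) 1) (s t : ℕ) :
    (((∑ i, ((⌊n * (x i : ℝ)⌋₊ : ℕ) : ZMod q) + ((s : ZMod q) - (t : ZMod q))).valMinAbs : ℝ) / n -
      ∑ i, (x i : ℝ)) ^ 2 ≤ 2 + 18 / n ^ 2 * ((s : ℝ) ^ 2 + (t : ℝ) ^ 2) := by
  have hn0 : (0 : ℝ) < n := by exact_mod_cast Nat.pos_of_ne_zero hn
  set T : ℕ := ∑ i, ⌊n * (x i : ℝ)⌋₊ with hT
  set k : ℤ := (s : ℤ) - t with hk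
  have hfloor : ∀ i, (⌊n * (x i : ℝ)⌋₊ : ℝ) ≤ n * x i := fun i =>
    Nat.floor_le (mul_nonneg hn0.le (x i).2.1)
  have hfloor' : ∀ i, n * (x i : ℝ) - 1 ≤ (⌊n * (x i : ℝ)⌋₊ : ℝ) := fun i =>
    (Nat.sub_one_lt_floor _).le
  have hTN : (T : ℤ) ≤ (n ^ 2 : ℕ) := by
    have : T ≤ n ^ 2 := by
      rw [sq]
      refine (Finset.sum_le_card_nsmul Finset.univ _ n fun i _ => ?_).trans (by simp)
      refine Nat.floor_le_of_le ?_
      exact mul_le_of_le_one_right hn0.le (x i).2.2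
    exact_mod_cast this
  have hcast : ∑ i, ((⌊n * (x i : ℝ)⌋₊ : ℕ) : ZMod q) + ((s : ZMod q) - (t : ZMod q)) =
      (((T : ℤ) + k : ℤ) : ZMod q) := by
    simp [hT, hk]
  have hdec := abs_valMinAbs_sub_le (q := q) (k := k) (by rw [hq]; push_cast; ring)
    (Int.natCast_nonneg T) hTN
  rw [hcast]
  set w : ℤ := (((T : ℤ) + k : ℤ) : ZMod q).valMinAbs
  have hdecR : |(w : ℝ) - T| ≤ 3 * |(k : ℝ)| := by exact_mod_cast hdec
  have hTx : |(T : ℝ) / n - ∑ i, (x i : ℝ)| ≤ 1 := by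
    have h1 : (T : ℝ) ≤ n * ∑ i, (x i : ℝ) := by
      rw [hT, Nat.cast_sum, Finset.mul_sum]
      exact Finset.sum_le_sum fun i _ => hfloor i
    have h2 : n * ∑ i, (x i : ℝ) - n ≤ (T : ℝ) := by
      have := Finset.sum_le_sum fun i (_ : i ∈ Finset.univ) => hfloor' i
      rw [Finset.sum_sub_distrib, ← Finset.mul_sum] at this
      rw [hT, Nat.cast_sum]
      simpa using this
    rw [abs_le, neg_le_sub_iff_le_add, sub_le_iff_le_add, div_le_iff₀ hn0, ← sub_le_iff_le_add,
      le_div_iff₀ hn0]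
    constructor <;> nlinarith
  set u : ℝ := ((w : ℝ) - T) / n with hu
  have hu2 : u ^ 2 ≤ 9 / n ^ 2 * (k : ℝ) ^ 2 := by
    rw [hu, div_pow, div_mul_eq_mul_div]
    gcongr
    have := pow_le_pow_left₀ (abs_nonneg _) hdecR 2
    rw [mul_pow, sq_abs, sq_abs] at this
    linarith
  have hk2 : (k : ℝ) ^ 2 ≤ (s : ℝ) ^ 2 + (t : ℝ) ^ 2 := by
    rw [hk]
    push_cast
    nlinarith [mul_nonneg (Nat.cast_nonneg (α := ℝ) s) (Nat.cast_nonneg (α := ℝ) t)]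
  have hu3 : u ^ 2 ≤ 9 / n ^ 2 * ((s : ℝ) ^ 2 + (t : ℝ) ^ 2) := hu2.trans (by gcongr)
  set r : ℝ := (T : ℝ) / n - ∑ i, (x i : ℝ) with hr
  have hsplit : (w : ℝ) / n - ∑ i, (x i : ℝ) = u + r := by rw [hu, hr]; ring
  have hr2 : r ^ 2 ≤ 1 := by rw [← sq_abs]; exact pow_le_one₀ (abs_nonneg _) hTx
  have h18 : 18 / (n : ℝ) ^ 2 * ((s : ℝ) ^ 2 + (t : ℝ) ^ 2) =
      2 * (9 / n ^ 2 * ((s : ℝ) ^ 2 + (t : ℝ) ^ 2)) := by ring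
  rw [hsplit, h18]
  -- `(u + r) ^ 2 ≤ 2 * u ^ 2 + 2 * r ^ 2`, with noise part `u` and rounding part `r`.
  nlinarith [sq_nonneg (u - r)]

theorem tsum_geomWeight_mul_tsum_add_le {α : ℝ} (hα : 0 ≤ α) (hα1 : α < 1) {a b : ℝ} (ha : 0 ≤ a)
    (hb : 0 ≤ b) :
    ∑' s, geomWeight α s * ∑' t, geomWeight α t *
        ENNReal.ofReal (a + b * ((s : ℝ) ^ 2 + (t : ℝ) ^ 2)) ≤
      ENNReal.ofReal (a + b * (4 / (1 - α) ^ 2)) := by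
  have h0 : 0 < 1 - α := sub_pos.2 hα1
  have hsplit : ∀ s t : ℕ, ENNReal.ofReal (a + b * ((s : ℝ) ^ 2 + (t : ℝ) ^ 2)) =
      ENNReal.ofReal a + (ENNReal.ofReal b * ENNReal.ofReal ((s : ℝ) ^ 2) +
        ENNReal.ofReal b * ENNReal.ofReal ((t : ℝ) ^ 2)) := by
    intro s t
    rw [ENNReal.ofReal_add ha (by positivity), ENNReal.ofReal_mul hb,
      ENNReal.ofReal_add (by positivity) (by positivity), mul_add]
  have hS := tsum_geomWeight_mul_sq_le hα hα1
  set S := ∑' s, geomWeight α s * ENNReal.ofReal ((s : ℝ) ^ 2) with hSdef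
  have heval : ∑' s, geomWeight α s * ∑' t, geomWeight α t *
        ENNReal.ofReal (a + b * ((s : ℝ) ^ 2 + (t : ℝ) ^ 2)) =
      ENNReal.ofReal a + (ENNReal.ofReal b * S + ENNReal.ofReal b * S) := by
    simp only [hsplit]
    simp only [mul_add, ENNReal.tsum_add, ENNReal.tsum_mul_right,
      tsum_geomWeight hα hα1, one_mul, mul_left_comm _ (ENNReal.ofReal b),
      ENNReal.tsum_mul_left, ← hSdef]
  rw [heval]
  have h4 : b * (4 / (1 - α) ^ 2) = b * (2 / (1 - α) ^ 2) + b * (2 / (1 - α) ^ 2) := by ring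
  rw [h4, ENNReal.ofReal_add ha (by positivity), ENNReal.ofReal_add (by positivity) (by positivity),
    ENNReal.ofReal_mul hb]
  gcongr

end Accuracy

/-! ### The summation protocol and its parameters -/

section Summation

variable {n m q : ℕ}

/-- The summation protocol: inputs are rounded to multiples of `1 / n`, and the noisy roundings
are shared additively modulo `q`. -/
noncomputable def summationProtocol (m q : ℕ) [NeZero m] [NeZero q] {α : ℝ} (hα : 0 ≤ α)
    (hα1 : α < 1) (hn : n ≠ 0) : Protocol (Set.Icc (0 : ℝ) 1) (ZMod q) ℝ n m where
  randomizer := noisyShare m hα hα1 hn fun x => ((⌊n * (x : ℝ)⌋₊ : ℕ) : ZMod q)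
  analyzer z := ((∑ j, ∑ i, z j i).valMinAbs : ℝ) / n

theorem mse_summationProtocol_le [NeZero m] [NeZero q] (hq : q = 4 * n ^ 2) {α : ℝ} (hα : 0 ≤ α)
    (hα1 : α < 1) (hn : n ≠ 0) {H : (Fin n → Fin m → ZMod q) → PMF (Fin m → Fin n → ZMod q)}
    (hH : IsShuffler H) :
    mse (fun x => (((summationProtocol m q hα hα1 hn).messages x).bind H).map
      (summationProtocol m q hα hα1 hn).analyzer) ≤
      ENNReal.ofReal (2 + 72 / (n * (1 - α)) ^ 2) := by
  refine iSup_le fun x => ?_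
  rw [tsum_map_mul]
  have h := tsum_noisyShare_bind_mul_sum hα hα1 hn
    (fun x : Set.Icc (0 : ℝ) 1 => ((⌊n * (x : ℝ)⌋₊ : ℕ) : ZMod q)) hH x
    fun w => ENNReal.ofReal (((w.valMinAbs : ℝ) / n - ∑ i, (x i : ℝ)) ^ 2)
  refine h.le.trans ?_
  have h72 : (2 : ℝ) + 72 / (n * (1 - α)) ^ 2 = 2 + 18 / (n : ℝ) ^ 2 * (4 / (1 - α) ^ 2) := by
    rw [mul_pow, div_mul_div_comm]
    norm_num
  rw [h72]
  refine le_trans ?_ (tsum_geomWeight_mul_tsum_add_le hα hα1 (by norm_num) (by positivity))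
  unfold discreteLaplaceMean
  gcongr with s t
  exact ENNReal.ofReal_le_ofReal (sq_decode_sub_le hn hq x s t)

theorem isDP_summationProtocol [NeZero m] [NeZero q] {α : ℝ} (hα : 0 ≤ α)
    (hα1 : α < 1) (hn : n ≠ 0) {H : (Fin n → Fin m → ZMod q) → PMF (Fin m → Fin n → ZMod q)}
    (hH : IsShuffler H) {ε δ : ℝ} (hε : α ^ n = Real.exp (-ε))
    (hδ : (1 + Real.exp ε) * (4 * n * √(q / 2 ^ m)) ≤ δ) :
    IsDP ε δ fun x => ((summationProtocol m q hα hα1 hn).messages x).bind H := by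
  refine isDP_noisyShare_bind hα hα1 hn (d := fun x : Set.Icc (0 : ℝ) 1 => ⌊n * (x : ℝ)⌋₊) hH
    (fun x => ?_) hε (by rwa [ZMod.card])
  exact Nat.floor_le_of_le (mul_le_of_le_one_right (Nat.cast_nonneg n) x.2.2)

theorem IsDP.mono {X V : Type*} {ε ε' δ : ℝ} (h : ε ≤ ε') {M : (Fin n → X) → PMF V}
    (hM : IsDP ε δ M) : IsDP ε' δ M := by
  intro x x' hxx' E
  refine le_trans ?_ (hM x x' hxx' E)
  gcongr

theorem half_le_mul_one_sub_exp {n : ℕ} (hn : n ≠ 0) {ε : ℝ} (hε : 0 < ε) (hε1 : ε ≤ 1) :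
    ε / 2 ≤ n * (1 - Real.exp (-(ε / n))) := by
  have hn1 : (1 : ℝ) ≤ n := by exact_mod_cast Nat.one_le_iff_ne_zero.2 hn
  set u := ε / n with hu
  have hu0 : 0 < u := by positivity
  have hu1 : u ≤ 1 := (div_le_one (by positivity)).2 (hε1.trans hn1)
  -- From `exp (-u) ≤ 1 / (1 + u)` and `u ≤ 1`.
  have hexp : Real.exp (-u) ≤ 1 - u / 2 := by
    have h := Real.add_one_le_exp u
    have hp : 0 < Real.exp (-u) := Real.exp_pos _
    have he : Real.exp u * Real.exp (-u) = 1 := by rw [← Real.exp_add]; simp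
    nlinarith
  have : ε = n * u := by rw [hu]; field_simp
  rw [this]
  nlinarith

theorem clog_four_mul_sq_le {n : ℕ} (hn : 2 ≤ n) :
    (Nat.clog 2 (4 * n ^ 2) : ℝ) ≤ 16 * Real.log n := by
  have hlog2 : (1 : ℝ) / 2 ≤ Real.log 2 := by linarith [Real.log_two_gt_d9]
  have hn2 : Real.log 2 ≤ Real.log n :=
    Real.log_le_log (by norm_num) (by exact_mod_cast hn)
  have hle : Nat.clog 2 (4 * n ^ 2) ≤ 4 * Nat.clog 2 n := by
    refine Nat.clog_le_of_le_pow ?_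
    calc 4 * n ^ 2 ≤ n ^ 2 * n ^ 2 := by gcongr; nlinarith
      _ = n ^ 4 := by ring
      _ ≤ (2 ^ Nat.clog 2 n) ^ 4 := by gcongr; exact Nat.le_pow_clog (by norm_num) n
      _ = 2 ^ (4 * Nat.clog 2 n) := by rw [← pow_mul, mul_comm]
  have hclog : (Nat.clog 2 n : ℝ) ≤ Real.log n / Real.log 2 + 1 := by
    rw [← Real.natCeil_logb_natCast]
    exact (Nat.ceil_lt_add_one (Real.logb_nonneg (by norm_num)
      (by exact_mod_cast (by omega : 1 ≤ n)))).le
  have hdiv : Real.log n / Real.log 2 ≤ 2 * Real.log n := by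
    rw [div_le_iff₀ (by linarith)]
    nlinarith
  have hleR : (Nat.clog 2 (4 * n ^ 2) : ℝ) ≤ 4 * Nat.clog 2 n := by exact_mod_cast hle
  linarith

theorem exists_number_of_messages {n : ℕ} (hn : 2 ≤ n) {δ : ℝ} (hδ : 0 < δ) (hδ1 : δ ≤ 1) :
    ∃ m : ℕ, 1 ≤ m ∧ (m : ℝ) ≤ 30 * Real.log (n / δ) ∧
      4 * (4 * n * √(((4 * n ^ 2 : ℕ) : ℝ) / 2 ^ m)) ≤ δ := by
  have hn2 : (2 : ℝ) ≤ n := by exact_mod_cast hn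
  have hnδ : (n : ℝ) ≤ n / δ := (le_div_iff₀ hδ).2 (mul_le_of_le_one_right (by linarith) hδ1)
  have hlog2 : (1 : ℝ) / 2 ≤ Real.log 2 := by linarith [Real.log_two_gt_d9]
  have hlog2pos : 0 < Real.log 2 := by linarith
  set L := Real.log (n / δ) with hL
  have hL2 : Real.log 2 ≤ L := Real.log_le_log (by norm_num) (hn2.trans hnδ)
  have hx : 0 < 14 * L / Real.log 2 := by
    have : 0 < L := hlog2pos.trans_le hL2
    positivity
  refine ⟨⌈14 * L / Real.log 2⌉₊, Nat.one_le_iff_ne_zero.2 (Nat.ceil_pos.2 hx).ne', ?_, ?_⟩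
  · have h1 := (Nat.ceil_lt_add_one hx.le).le
    have h2 : 14 * L / Real.log 2 ≤ 28 * L := by
      rw [div_le_iff₀ hlog2pos]
      nlinarith
    linarith
  · set m := ⌈14 * L / Real.log 2⌉₊
    have hm : 14 * L ≤ m * Real.log 2 := (div_le_iff₀ hlog2pos).1 (Nat.le_ceil _)
    have hpow : (n / δ : ℝ) ^ 14 ≤ 2 ^ m := by
      rw [← Real.log_le_log_iff (by positivity) (by positivity), Real.log_pow, Real.log_pow]
      exact_mod_cast hm
    -- Squaring the target gives exactly this inequality. The exponent `14` is `10 + 4`: `1024 = 2 ^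
    -- 10 ≤ n ^ 10`, and the spare powers of `1 / δ` only help.
    have hpow2 : (1024 : ℝ) * n ^ 4 ≤ δ ^ 2 * 2 ^ m := by
      calc (1024 : ℝ) * n ^ 4 = 2 ^ 10 * (n : ℝ) ^ 4 := by norm_num
        _ ≤ (n : ℝ) ^ 10 * (n : ℝ) ^ 4 := by gcongr
        _ = (n : ℝ) ^ 14 / 1 := by ring
        _ ≤ (n : ℝ) ^ 14 / δ ^ 12 := by
          gcongr
          exact pow_le_one₀ hδ.le hδ1
        _ = δ ^ 2 * (n / δ) ^ 14 := by field_simp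
        _ ≤ δ ^ 2 * 2 ^ m := by gcongr
    have hsqrt : √(((4 * n ^ 2 : ℕ) : ℝ) / 2 ^ m) ≤ δ / (16 * n) := by
      rw [Real.sqrt_le_left (by positivity), div_pow, div_le_div_iff₀ (by positivity)
        (by positivity)]
      push_cast
      nlinarith
    calc 4 * (4 * n * √(((4 * n ^ 2 : ℕ) : ℝ) / 2 ^ m)) ≤ 4 * (4 * n * (δ / (16 * n))) := by gcongr
      _ = δ := by field_simp; norm_num

end Summation

end Shuffle

theorem mainTheorem7 :
    ∃ Cmsg Cbit : ℝ, ∀ ε₀ : ℝ, 0 < ε₀ → ∃ Cmse : ℝ,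
      ∀ n : ℕ, 2 ≤ n → ∀ ε : ℝ, 0 < ε → ε ≤ ε₀ → ∀ δ : ℝ, 0 < δ → δ ≤ 1 →
        ∃ (m : ℕ) (Y : Type) (_ : Fintype Y)
          (P : Shuffle.Protocol (Set.Icc (0 : ℝ) 1) Y ℝ n m),
          1 ≤ m ∧ (m : ℝ) ≤ Cmsg * Real.log (n / δ) ∧
          (Shuffle.messageBits Y : ℝ) ≤ Cbit * Real.log n ∧
          Shuffle.IsDP ε δ P.parallelView ∧
          Shuffle.mse (fun x => (P.parallelView x).map P.analyzer) ≤
            ENNReal.ofReal (Cmse / ε ^ 2) ∧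
          Shuffle.IsDP ε δ P.singleView ∧
          Shuffle.mse (fun x => (P.singleView x).map P.analyzer) ≤
            ENNReal.ofReal (Cmse / ε ^ 2) := by
  -- `290 = 288 + 2`: noise `72 / (η / 2) ^ 2` plus rounding `2 ≤ 2 / η ^ 2`. The factor `1 + ε₀ ^
  -- 2` pays for replacing `ε` by `min ε 1`.
  refine ⟨30, 16, fun ε₀ hε₀ => ⟨290 * (1 + ε₀ ^ 2), ?_⟩⟩
  intro n hn ε hε hεε₀ δ hδ hδ1
  have hn0 : n ≠ 0 := by omega
  have hnR : (0 : ℝ) < n := by exact_mod_cast Nat.pos_of_ne_zero hn0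
  obtain ⟨m, hm1, hmlog, hmδ⟩ := Shuffle.exists_number_of_messages hn hδ hδ1
  have : NeZero m := ⟨by omega⟩
  have : NeZero (4 * n ^ 2) := ⟨by positivity⟩
  -- Capping at `1` keeps `1 + exp η ≤ 4`, so `m` need not depend on `ε₀`; privacy at `η` implies
  -- privacy at `ε`.
  set η := min ε 1 with hη
  have hη0 : 0 < η := lt_min hε one_pos
  have hη1 : η ≤ 1 := min_le_right _ _
  have hα : 0 ≤ Real.exp (-(η / n)) := (Real.exp_pos _).le
  have hα1 : Real.exp (-(η / n)) < 1 := by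
    rw [Real.exp_lt_one_iff, neg_lt_zero]
    positivity
  have hαn : Real.exp (-(η / n)) ^ n = Real.exp (-η) := by
    rw [← Real.exp_nat_mul]
    congr 1
    field_simp
  have hdelta : (1 + Real.exp η) * (4 * n * √(((4 * n ^ 2 : ℕ) : ℝ) / 2 ^ m)) ≤ δ := by
    refine le_trans ?_ hmδ
    gcongr
    have := Real.exp_le_exp.2 hη1
    linarith [Real.exp_one_lt_d9]
  have hmse : (2 : ℝ) + 72 / (n * (1 - Real.exp (-(η / n)))) ^ 2 ≤ 290 * (1 + ε₀ ^ 2) / ε ^ 2 := by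
    have h1 : 72 / (n * (1 - Real.exp (-(η / n)))) ^ 2 ≤ 72 / (η / 2) ^ 2 := by
      gcongr
      exact Shuffle.half_le_mul_one_sub_exp hn0 hη0 hη1
    have h2 : (2 : ℝ) + 72 / (η / 2) ^ 2 ≤ 290 / η ^ 2 := by
      have : (72 : ℝ) / (η / 2) ^ 2 = 288 / η ^ 2 := by field_simp; norm_num
      rw [this, le_div_iff₀ (by positivity), add_mul, div_mul_cancel₀ _ (by positivity)]
      nlinarith
    have h3 : 290 / η ^ 2 ≤ 290 * (1 + ε₀ ^ 2) / ε ^ 2 := by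
      rw [div_le_div_iff₀ (by positivity) (by positivity), mul_assoc]
      gcongr
      rcases min_choice ε 1 with h | h
      · rw [hη, h]
        nlinarith [sq_nonneg (ε₀ * ε)]
      · rw [hη, h]
        nlinarith
    linarith
  refine ⟨m, ZMod (4 * n ^ 2), inferInstance,
    Shuffle.summationProtocol m (4 * n ^ 2) hα hα1 hn0, hm1, hmlog, ?_, ?_, ?_, ?_, ?_⟩
  · rw [Shuffle.messageBits, ZMod.card]
    exact Shuffle.clog_four_mul_sq_le hn
  · exact (Shuffle.isDP_summationProtocol hα hα1 hn0 Shuffle.isShuffler_parallelShuffle hαn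
      hdelta).mono (min_le_left _ _)
  · exact (Shuffle.mse_summationProtocol_le rfl hα hα1 hn0
      Shuffle.isShuffler_parallelShuffle).trans (ENNReal.ofReal_le_ofReal hmse)
  · exact (Shuffle.isDP_summationProtocol hα hα1 hn0 Shuffle.isShuffler_singleShuffle hαn
      hdelta).mono (min_le_left _ _)
  · exact (Shuffle.mse_summationProtocol_le rfl hα hα1 hn0
      Shuffle.isShuffler_singleShuffle).trans (ENNReal.ofReal_le_ofReal hmse)
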